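/- A deterministic MDP with finite state set $S$, $|S|=n\ge 1$, and finite action set $A$, $|A|=k\ge 1$, is given by a transition function $T:S\times A\to S$ and a reward function $R:S\times A\to\mathbb R$. For a policy $\pi:S\to A$ and a discount factor $\gamma\in[0,1)$ put $$V^\pi_\gamma(s)=\sum_{t\ge 0}\gamma^t R(s_t,\pi(s_t)),\quad s_0=s,\ s_{t+1}=T(s_t,\pi(s_t)),\qquad Q^\pi_\gamma(s,a)=R(s,a)+\gamma V^\pi_\gamma(T(s,a)).$$ Howard's policy iteration starts from an arbitrary policy. It stops at the current policy $\pi$ if $Q^\pi_\gamma(s,a)\le Q^\pi_\gamma(s,\pi(s))$ for all $s\in S$, $a\in A$; otherwise it replaces $\pi$ by a policy $\pi'$ with $\pi'(s)\in\arg\max_{a\in A}Q^\pi_\gamma(s,a)$ for every $s\in S$, ties being broken arbitrarily (for instance, keeping $\pi(s)$ whenever $\pi(s)$ is itself a maximiser). Each such replacement is one iteration. **Theorem.** For integers $n,b\ge 1$ let $X(n,b)=\sqrt{nb}\,\log(n/b)+b$, where $\log$ is the natural logarithm. There is an absolute constant $C>0$ such that for all integers $n,k,b\ge 1$, every deterministic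 MDP with $n$ states, $k$ actions and all rewards in $\{0,1,\dots,2^b-1\}$, and every discount factor $\gamma\in[0,1)$, Howard's policy iteration, from any initial policy and with any tie-breaking, stops within at most $$B_C(n,k,b)=n\,k\,X(n,b)\,\exp\bigl(C\,X(n,b)\bigr)$$ iterations. The bound does not depend on $\gamma$, and it is subexponential in $n$: for fixed $k,b\ge 1$, $\log B_C(n,k,b)=o(n)$ as $n\to\infty$. -/

import Mathlib

open Filter Asymptotics

/-- A deterministic Markov decision problem with state set `S` and action set `A`: taking action `a`
in state `s` earns the reward `R s a` and moves to the state `T s a`. -/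
structure DMDP (S A : Type*) where
  T : S → A → S
  R : S → A → ℝ

namespace DMDP

variable {S A : Type*} (M : DMDP S A)

/-- The state reached after `t` steps when the policy `π` is followed from `s`. -/
def trajectory (π : S → A) (s : S) (t : ℕ) : S :=
  (fun x => M.T x (π x))^[t] s

/-- The value `V^π_γ(s) = ∑_{t ≥ 0} γ^t R(s_t, π(s_t))` with `s_0 = s` and
`s_{t+1} = T(s_t, π(s_t))`. For finitely many states and `γ ∈ [0,1)` the series converges
absolutely. -/
noncomputable def value (γ : ℝ) (π : S → A) (s : S) : ℝ :=
  ∑' t : ℕ, γ ^ t * M.R (M.trajectory π s t) (π (M.trajectory π s t))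

/-- The action value `Q^π_γ(s, a) = R(s, a) + γ V^π_γ(T(s, a))`. -/
noncomputable def qValue (γ : ℝ) (π : S → A) (s : S) (a : A) : ℝ :=
  M.R s a + γ * M.value γ π (M.T s a)

/-- A state is improvable under `π` if some action has a larger Q-value than `π(s)`. -/
def Improvable (γ : ℝ) (π : S → A) (s : S) : Prop :=
  ∃ a : A, M.qValue γ π s (π s) < M.qValue γ π s a

/-- Policy iteration stops at `π` if no state is improvable under `π`. -/
def Terminal (γ : ℝ) (π : S → A) : Prop :=
  ∀ s : S, ¬ M.Improvable γ π s

/-- One iteration of Howard's policy iteration: in every state the new policy picks an action that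
maximises the Q-value of the old one. Ties may be broken in any way; in particular the rule that
keeps `π(s)` in every state that is not improvable is an instance. -/
def HowardStep (γ : ℝ) (π π' : S → A) : Prop :=
  ∀ (s : S) (a : A), M.qValue γ π s a ≤ M.qValue γ π s (π' s)

/-- `π 0, π 1, …` is a run of Howard's policy iteration, started from `π 0`: as long as the
algorithm has not stopped, each policy arises from the previous one by one iteration. (Entries after
a terminal policy are padding.) -/
def HowardRun (γ : ℝ) (π : ℕ → S → A) : Prop :=
  ∀ t : ℕ, (∀ i ≤ t, ¬ M.Terminal γ (π i)) → M.HowardStep γ (π t) (π (t + 1))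

end DMDP

/-- `√(n b) log(n / b) + b`, with the natural logarithm. -/
noncomputable def howardExponent (n b : ℕ) : ℝ :=
  Real.sqrt ((n : ℝ) * b) * Real.log ((n : ℝ) / b) + b

/-- `n k (√(n b) log(n / b) + b) exp(C (√(n b) log(n / b) + b))`. -/
noncomputable def howardBound (C : ℝ) (n k b : ℕ) : ℝ :=
  (n : ℝ) * k * howardExponent n b * Real.exp (C * howardExponent n b)

/-! Put X = `howardExponent n b` and δ = exp(-44X). The proof bounds the iterations for γ ≤ 1 - δ
and shows that any larger γ makes the algorithm behave as it does at 1 - δ.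

For fixed γ, each iteration contracts the distance to the optimal value by γ. At a nonterminal
policy, consider a state with the largest one-step loss `gap`: the action used there cannot be used
there again τ or more iterations later, once γ^τ < 1 - γ. Only n k state-action pairs can be lost,
so n k τ iterations suffice (`HowardRun.exists_terminal`).

Trajectories are eventually periodic, so a comparison of two Q-values of one policy is, after
clearing denominators, the sign of an integer polynomial in γ of degree at most 3n with coefficients
at most 2^(b+2) in modulus (`exists_polynomial_qValue_le_iff`). Such a polynomial, if nonzero,
vanishes at 1 only to order O(√(nb) + b) (`le_of_X_sub_one_pow_dvd`). The first nonzero Taylor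
coefficient at 1 is a nonzero integer and dominates the later terms close to 1, so there is no zero
in [1 - δ, 1) (`aeval_one_sub_ne_zero`, `exists_choose_bound`). All comparisons are therefore
constant there, and a run for γ > 1 - δ is also a run for 1 - δ. -/

namespace DMDP

/-! ### Howard's policy iteration at a fixed discount factor -/

variable {n k : ℕ} (M : DMDP (Fin n) (Fin k))

theorem exists_abs_reward_le : ∃ B : ℝ, ∀ s a, |M.R s a| ≤ B := by
  obtain ⟨B, hB⟩ := (Set.finite_range (fun p : Fin n × Fin k => |M.R p.1 p.2|)).bddAbove
  exact ⟨B, fun s a => hB ⟨(s, a), rfl⟩⟩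

theorem summable_discounted {γ : ℝ} (h0 : 0 ≤ γ) (h1 : γ < 1) (x : ℕ → Fin n) (u : ℕ → Fin k) :
    Summable fun t : ℕ => γ ^ t * M.R (x t) (u t) := by
  obtain ⟨B, hB⟩ := M.exists_abs_reward_le
  refine Summable.of_norm_bounded (g := fun t : ℕ => γ ^ t * B)
    ((summable_geometric_of_lt_one h0 h1).mul_right B) fun t => ?_
  rw [Real.norm_eq_abs, abs_mul, abs_of_nonneg (pow_nonneg h0 t)]
  exact mul_le_mul_of_nonneg_left (hB _ _) (pow_nonneg h0 t)

theorem value_eq_qValue {γ : ℝ} (h0 : 0 ≤ γ) (h1 : γ < 1) (π : Fin n → Fin k) (s : Fin n) :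
    M.value γ π s = M.qValue γ π s (π s) := by
  have h := M.summable_discounted h0 h1 (M.trajectory π s) (fun t => π (M.trajectory π s t))
  rw [value, h.tsum_eq_zero_add, qValue, value, ← tsum_mul_left]
  congr 1
  · simp [trajectory]
  · refine tsum_congr fun t => ?_
    simp only [trajectory, Function.iterate_succ, Function.comp, pow_succ]
    ring

/-- At a state minimising the difference of the two values, that difference is at least γ times its
value at a successor, hence at least γ times the minimum; so the minimum is nonnegative. -/
theorem value_le_value_of_howardStep {γ : ℝ} (h0 : 0 ≤ γ) (h1 : γ < 1) {π π' : Fin n → Fin k}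
    (h : M.HowardStep γ π π') (s : Fin n) : M.value γ π s ≤ M.value γ π' s := by
  obtain ⟨z, -, hz⟩ := Finset.exists_min_image Finset.univ
    (fun s => M.value γ π' s - M.value γ π s) ⟨s, Finset.mem_univ s⟩
  have h2 := hz (M.T z (π' z)) (Finset.mem_univ _)
  have h3 := h z (π z)
  have h4 := hz s (Finset.mem_univ _)
  have h5 := M.value_eq_qValue h0 h1 π z
  have h6 := M.value_eq_qValue h0 h1 π' z
  simp only [qValue] at *
  nlinarith [mul_le_mul_of_nonneg_left h2 h0]

theorem qValue_le_value_of_howardStep {γ : ℝ} (h0 : 0 ≤ γ) (h1 : γ < 1) {π π' : Fin n → Fin k}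
    (h : M.HowardStep γ π π') (s : Fin n) (a : Fin k) :
    M.qValue γ π s a ≤ M.value γ π' s := by
  refine (h s a).trans ?_
  rw [M.value_eq_qValue h0 h1 π' s, qValue, qValue]
  have := M.value_le_value_of_howardStep h0 h1 h (M.T s (π' s))
  gcongr

/-- A solution of the Bellman optimality equation. -/
def IsOptimalValue (γ : ℝ) (W : Fin n → ℝ) : Prop :=
  (∀ s a, M.R s a + γ * W (M.T s a) ≤ W s) ∧ ∀ s, ∃ a, W s = M.R s a + γ * W (M.T s a)

/-- The Bellman operator `F` is a γ-contraction in the sup norm, so Banach's fixed-point theorem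
applies. -/
theorem exists_isOptimalValue (hk : 1 ≤ k) {γ : ℝ} (h0 : 0 ≤ γ) (h1 : γ < 1) :
    ∃ W, M.IsOptimalValue γ W := by
  have hne : (Finset.univ : Finset (Fin k)).Nonempty := ⟨⟨0, hk⟩, Finset.mem_univ _⟩
  let F : (Fin n → ℝ) → Fin n → ℝ := fun W s =>
    Finset.univ.sup' hne fun a => M.R s a + γ * W (M.T s a)
  have hle : ∀ W W' s, F W s ≤ F W' s + γ * dist W W' := by
    intro W W' s
    refine Finset.sup'_le _ _ fun a _ => ?_
    have h2 : M.R s a + γ * W' (M.T s a) ≤ F W' s :=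
      Finset.le_sup' (fun a => M.R s a + γ * W' (M.T s a)) (Finset.mem_univ a)
    have h3 : W (M.T s a) - W' (M.T s a) ≤ dist W W' :=
      (le_abs_self _).trans ((Real.dist_eq _ _).symm.le.trans (dist_le_pi_dist W W' _))
    nlinarith [mul_le_mul_of_nonneg_left h3 h0]
  have hF : ContractingWith ⟨γ, h0⟩ F := by
    refine ⟨by exact_mod_cast h1, LipschitzWith.of_dist_le_mul fun W W' => ?_⟩
    refine (dist_pi_le_iff (mul_nonneg h0 dist_nonneg)).2 fun s => ?_
    rw [Real.dist_eq, abs_sub_le_iff]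
    have h2 := hle W W' s
    have h3 := hle W' W s
    rw [dist_comm W' W] at h3
    constructor
    · simpa using by linarith
    · simpa using by linarith
  have hfix : F (ContractingWith.fixedPoint F hF) = ContractingWith.fixedPoint F hF :=
    hF.fixedPoint_isFixedPt
  refine ⟨ContractingWith.fixedPoint F hF, fun s a => ?_, fun s => ?_⟩
  · conv_rhs => rw [← hfix]
    exact Finset.le_sup' (fun a => M.R s a + γ * ContractingWith.fixedPoint F hF (M.T s a))
      (Finset.mem_univ a)
  · obtain ⟨a, -, ha⟩ := Finset.exists_mem_eq_sup' hne
      (fun a => M.R s a + γ * ContractingWith.fixedPoint F hF (M.T s a))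
    refine ⟨a, ?_⟩
    conv_lhs => rw [← hfix]
    exact ha

/-- The loss incurred by following `π` for one step and an optimal policy afterwards. -/
def gap (γ : ℝ) (W : Fin n → ℝ) (s : Fin n) (a : Fin k) : ℝ :=
  W s - (M.R s a + γ * W (M.T s a))

variable {M}

namespace IsOptimalValue

variable {γ : ℝ} {W : Fin n → ℝ}

theorem value_le (hW : M.IsOptimalValue γ W) (h0 : 0 ≤ γ) (h1 : γ < 1) (π : Fin n → Fin k)
    (s : Fin n) : M.value γ π s ≤ W s := by
  obtain ⟨z, -, hz⟩ := Finset.exists_max_image Finset.univ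
    (fun s => M.value γ π s - W s) ⟨s, Finset.mem_univ s⟩
  have h2 := hz (M.T z (π z)) (Finset.mem_univ _)
  have h3 := hW.1 z (π z)
  have h4 := hz s (Finset.mem_univ _)
  have h5 := M.value_eq_qValue h0 h1 π z
  simp only [qValue] at *
  nlinarith [mul_le_mul_of_nonneg_left h2 h0]

/-- An iteration gains at least as much as one application of the Bellman operator to the old value,
which contracts towards `W`. -/
theorem sub_value_le_of_howardStep (hW : M.IsOptimalValue γ W) (h0 : 0 ≤ γ) (h1 : γ < 1)
    {π π' : Fin n → Fin k} (h : M.HowardStep γ π π') {d : ℝ}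
    (hd : ∀ s, W s - M.value γ π s ≤ d) (s : Fin n) : W s - M.value γ π' s ≤ γ * d := by
  obtain ⟨a, ha⟩ := hW.2 s
  have h2 := M.qValue_le_value_of_howardStep h0 h1 h s a
  have h3 := mul_le_mul_of_nonneg_left (hd (M.T s a)) h0
  rw [qValue] at h2
  linarith

theorem gap_le (hW : M.IsOptimalValue γ W) (h0 : 0 ≤ γ) (h1 : γ < 1) (π : Fin n → Fin k)
    (s : Fin n) : M.gap γ W s (π s) ≤ W s - M.value γ π s := by
  have h2 := M.value_eq_qValue h0 h1 π s
  have h3 := mul_le_mul_of_nonneg_left (hW.value_le h0 h1 π (M.T s (π s))) h0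
  rw [qValue] at h2
  rw [gap]
  linarith

/-- The total loss is a discounted sum of one-step losses along the trajectory. Together with
`gap_le` this makes the largest gap comparable to the largest total loss, up to the factor 1 - γ. -/
theorem sub_value_le_of_gap_le (h0 : 0 ≤ γ) (h1 : γ < 1)
    {π : Fin n → Fin k} {d : ℝ} (hd : ∀ s, M.gap γ W s (π s) ≤ d) (s : Fin n) :
    (1 - γ) * (W s - M.value γ π s) ≤ d := by
  obtain ⟨z, -, hz⟩ := Finset.exists_max_image Finset.univ
    (fun s => W s - M.value γ π s) ⟨s, Finset.mem_univ s⟩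
  have h2 := hz (M.T z (π z)) (Finset.mem_univ _)
  have h3 := hd z
  have h4 := hz s (Finset.mem_univ _)
  have h5 := M.value_eq_qValue h0 h1 π z
  simp only [qValue, gap] at *
  nlinarith [mul_le_mul_of_nonneg_left h2 h0,
    mul_le_mul_of_nonneg_left h4 (sub_nonneg.2 h1.le)]

theorem exists_gap_pos (hW : M.IsOptimalValue γ W) (h0 : 0 ≤ γ) (h1 : γ < 1)
    {π : Fin n → Fin k} (hπ : ¬ M.Terminal γ π) :
    ∃ s, 0 < M.gap γ W s (π s) ∧ ∀ s', M.gap γ W s' (π s') ≤ M.gap γ W s (π s) := by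
  simp only [Terminal, Improvable, not_forall, not_not] at hπ
  obtain ⟨s₀, a, ha⟩ := hπ
  obtain ⟨z, -, hz⟩ := Finset.exists_max_image Finset.univ
    (fun s => M.gap γ W s (π s)) ⟨s₀, Finset.mem_univ s₀⟩
  refine ⟨z, ?_, fun s' => hz s' (Finset.mem_univ _)⟩
  by_contra! hneg
  have hd : ∀ s, M.gap γ W s (π s) ≤ 0 := fun s => (hz s (Finset.mem_univ _)).trans hneg
  have heq : ∀ s, M.value γ π s = W s := fun s => by
    have h2 := sub_value_le_of_gap_le h0 h1 hd s
    have h3 := hW.value_le h0 h1 π s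
    nlinarith
  rw [← M.value_eq_qValue h0 h1, heq, qValue, heq] at ha
  linarith [hW.1 s₀ a]

end IsOptimalValue

-- Each nonterminal policy condemns one state-action pair, which is never used again after a delay
-- of τ; pigeonhole over the n k pairs then bounds the run.
open IsOptimalValue in
theorem HowardRun.exists_terminal (hk : 1 ≤ k) {γ : ℝ} (h0 : 0 ≤ γ) (h1 : γ < 1)
    {π : ℕ → Fin n → Fin k} (hrun : M.HowardRun γ π) {τ : ℕ} (hτ : γ ^ τ < 1 - γ) :
    ∃ t ≤ n * k * τ, M.Terminal γ (π t) := by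
  by_contra! hnt
  obtain ⟨W, hW⟩ := M.exists_isOptimalValue hk h0 h1
  have hstep : ∀ t ≤ n * k * τ, M.HowardStep γ (π t) (π (t + 1)) := fun t ht =>
    hrun t fun i hi => hnt i (hi.trans ht)
  have : Nonempty (Fin n) := ⟨(hW.exists_gap_pos h0 h1 (hnt 0 (Nat.zero_le _))).choose⟩
  choose! z hz using fun t (ht : t ≤ n * k * τ) => hW.exists_gap_pos h0 h1 (hnt t ht)
  have hdecay : ∀ t d : ℕ, t + d ≤ n * k * τ → ∀ s, W s - M.value γ (π (t + d)) s ≤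
      γ ^ d * (M.gap γ W (z t) (π t (z t)) / (1 - γ)) := by
    intro t d
    induction d with
    | zero =>
      intro ht s
      rw [pow_zero, one_mul, add_zero, le_div_iff₀ (by linarith), mul_comm]
      exact sub_value_le_of_gap_le h0 h1 (hz t ht).2 s
    | succ d ih =>
      intro ht s
      have := hW.sub_value_le_of_howardStep h0 h1 (hstep (t + d) (by omega)) (ih (by omega)) s
      rw [pow_succ', mul_assoc]
      exact this
  -- If the action recurred, its unchanged positive gap g would satisfy g ≤ γ^d g / (1 - γ) with d ≥
  -- τ, contradicting γ^d < 1 - γ.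
  have hne : ∀ t u : ℕ, t + τ ≤ u → u ≤ n * k * τ → π u (z t) ≠ π t (z t) := by
    intro t u htu hu heq
    obtain ⟨d, rfl⟩ := Nat.exists_eq_add_of_le (show t ≤ u by omega)
    have h2 := (hW.gap_le h0 h1 (π (t + d)) (z t)).trans (hdecay t d hu (z t))
    rw [heq] at h2
    have h3 := (hz t (by omega)).1
    have h4 : γ ^ d < 1 - γ := (pow_le_pow_of_le_one h0 h1.le (by omega)).trans_lt hτ
    have h5 : 0 < 1 - γ := by linarith
    rw [mul_div_assoc', le_div_iff₀ h5] at h2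
    nlinarith
  have hcard : Fintype.card (Fin n × Fin k) < Fintype.card (Fin (n * k + 1)) := by simp
  -- Sampling at the n k + 1 times 0, τ, …, n k τ makes any two samples at least τ apart.
  obtain ⟨i, j, hij, he⟩ := Fintype.exists_ne_map_eq_of_card_lt
    (fun i : Fin (n * k + 1) => (z (i * τ), π (i * τ) (z (i * τ)))) hcard
  wlog hlt : i < j generalizing i j
  · exact this j i hij.symm he.symm (lt_of_le_of_ne (not_lt.1 hlt) hij.symm)
  simp only [Prod.mk.injEq] at he
  refine hne (i * τ) (j * τ) ?_ ?_ ?_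
  · calc (i : ℕ) * τ + τ = (i + 1) * τ := by ring
      _ ≤ j * τ := Nat.mul_le_mul_right _ (by exact_mod_cast hlt)
  · exact Nat.mul_le_mul_right _ (by omega)
  · rw [he.2, he.1]

end DMDP

/-! ### Order of vanishing at 1 of integer polynomials with bounded coefficients -/

namespace Polynomial

/-- Take Q = (T_k - 1)/(X - 1) with T_k the Chebyshev polynomial. Then Q(1) = T_k'(1) = k², while
|T_k| ≤ 1 on [-1, 1] makes Q small away from 1. The map x ↦ 1 - 2x/N carries [0, N] to [-1, 1] and 0
to 1. -/
theorem exists_natDegree_lt_abs_eval_le (k N : ℕ) (hk : 1 ≤ k) (hN : 1 ≤ N) :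
    ∃ K : ℝ[X], K.natDegree ≤ k - 1 ∧ K.eval 0 = 1 ∧
      ∀ x : ℝ, 0 < x → x ≤ N → |K.eval x| ≤ N / (k ^ 2 * x) := by
  have hk' : (0 : ℝ) < k := by exact_mod_cast hk
  have hN' : (0 : ℝ) < N := by exact_mod_cast hN
  obtain ⟨Q, hQ⟩ : (X - C 1 : ℝ[X]) ∣ Chebyshev.T ℝ k - 1 := by
    rw [dvd_iff_isRoot]; simp
  have hQ1 : Q.eval 1 = k ^ 2 := by
    have h := congrArg (fun p => (derivative p).eval 1) hQ
    rw [derivative_sub, eval_sub, Chebyshev.derivative_T_eval_one] at h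
    simp [derivative_mul] at h
    rw [← h]
  have hQd : Q.natDegree ≤ k - 1 := by
    have hQ0 : Q ≠ 0 := by
      rintro rfl
      rw [eval_zero] at hQ1
      exact (pow_pos hk' 2).ne hQ1
    have h : (Chebyshev.T ℝ k - 1).natDegree ≤ k := by
      refine (natDegree_sub_le _ _).trans ?_
      simp
    rw [hQ, natDegree_mul (X_sub_C_ne_zero 1) hQ0, natDegree_X_sub_C] at h
    omega
  refine ⟨C (1 / (k : ℝ) ^ 2) * Q.comp (1 - C (2 / (N : ℝ)) * X), ?_, ?_, ?_⟩
  · refine (natDegree_C_mul_le _ _).trans (natDegree_comp_le.trans ?_)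
    have h : (1 - C (2 / (N : ℝ)) * X).natDegree ≤ 1 := by
      refine (natDegree_sub_le _ _).trans ?_
      rw [natDegree_one, max_eq_right (Nat.zero_le _)]
      exact (natDegree_C_mul_le _ _).trans natDegree_X_le
    calc _ ≤ Q.natDegree * 1 := Nat.mul_le_mul_left _ h
      _ ≤ _ := by simpa using hQd
  · simp [eval_comp, hQ1, hk'.ne']
  · intro x hx hxN
    have hy : (1 - 2 / N * x) ∈ Set.Icc (-1 : ℝ) 1 := by
      have : x / N ≤ 1 := (div_le_one hN').2 hxN
      have h2 : 0 < x / N := by positivity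
      have h3 : 2 / N * x = 2 * (x / N) := by ring
      constructor <;> rw [h3] <;> linarith
    have hT := Chebyshev.eval_T_real_mem_Icc k hy
    have h := congrArg (fun p => p.eval (1 - 2 / N * x)) hQ
    simp only [eval_sub, eval_one, eval_mul, eval_X, eval_C] at h
    have hQx : Q.eval (1 - 2 / N * x) =
        (1 - (Chebyshev.T ℝ k).eval (1 - 2 / N * x)) * (N / (2 * x)) := by
      field_simp at h ⊢
      linarith
    have heval : (C (1 / (k : ℝ) ^ 2) * Q.comp (1 - C (2 / (N : ℝ)) * X)).eval x =
        (1 - (Chebyshev.T ℝ k).eval (1 - 2 / N * x)) * (N / (2 * x)) / k ^ 2 := by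
      simp [eval_comp, hQx]
      ring
    have h2 : 0 ≤ 1 - (Chebyshev.T ℝ k).eval (1 - 2 / N * x) := by linarith [hT.2]
    rw [heval, abs_of_nonneg (by positivity)]
    calc _ ≤ 2 * (N / (2 * x)) / (k : ℝ) ^ 2 := by
          gcongr
          linarith [hT.1]
      _ = _ := by field_simp

theorem sum_Icc_one_div_sq_le (N : ℕ) : ∑ j ∈ Finset.Icc 1 N, 1 / (j : ℝ) ^ 2 ≤ 2 := by
  suffices h : ∀ N : ℕ, ∑ j ∈ Finset.Icc 1 (N + 1), 1 / (j : ℝ) ^ 2 ≤ 2 - 1 / ((N : ℝ) + 1) by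
    cases N with
    | zero => simp
    | succ N => exact (h N).trans (by have : (0 : ℝ) ≤ 1 / (N + 1) := by positivity
                                      linarith)
  intro N
  induction N with
  | zero => norm_num
  | succ N ih =>
    rw [Finset.sum_Icc_succ_top (by omega)]
    have : 1 / (((N + 1 + 1 : ℕ) : ℝ)) ^ 2 ≤ 1 / (N + 1) - 1 / (N + 1 + 1) := by
      rw [div_sub_div _ _ (by positivity) (by positivity),
        div_le_div_iff₀ (by positivity) (by positivity)]
      push_cast
      nlinarith [(Nat.cast_nonneg N : (0 : ℝ) ≤ N)]
    push_cast at *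
    linarith

theorem _root_.Nat.sq_le_two_mul_two_pow (r : ℕ) : r ^ 2 ≤ 2 * 2 ^ r := by
  rcases lt_or_ge r 3 with h | h
  · interval_cases r <;> norm_num
  · induction r, h using Nat.le_induction with
    | base => norm_num
    | succ r hr ih => rw [pow_succ 2 r]; nlinarith

/-- A polynomial of low degree concentrated at 0 among 0, …, N, to be tested against the coefficient
sequence in `le_of_X_sub_one_pow_dvd`. The factor ∏ (1 - x/i), i ≤ r, kills 1, …, r and is at most
j^r/r! beyond; K^(r+2) cancels this growth and leaves a summable 1/j². -/
theorem exists_eval_zero_eq_one_sum_abs_eval_lt (r N : ℕ) (hr : 1 ≤ r) (hN : 1 ≤ N) :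
    ∃ f : ℝ[X], (f.natDegree : ℝ) ≤ r + 3 * √(12 * N * r) ∧ f.eval 0 = 1 ∧
      2 ^ r * ∑ j ∈ Finset.Icc 1 N, |f.eval (j : ℝ)| < 1 := by
  have hr' : (0 : ℝ) < r := by exact_mod_cast hr
  have hN' : (0 : ℝ) < N := by exact_mod_cast hN
  -- This makes |K(j)| ≤ r/(12j). With r^r/r! ≤ 3^r the exponential factor is (3/12)^r = 4^(-r),
  -- enough to beat 2^r.
  set k : ℕ := ⌈√(12 * N / r)⌉₊ with hk
  have hs : 0 < √(12 * N / r) := Real.sqrt_pos.2 (by positivity)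
  have hk1 : 1 ≤ k := Nat.ceil_pos.2 hs
  have hk' : (0 : ℝ) < k := by exact_mod_cast hk1
  have hksq : 12 * N / r ≤ (k : ℝ) ^ 2 := by
    rw [← Real.sq_sqrt (show 0 ≤ 12 * (N : ℝ) / r by positivity)]
    gcongr
    exact Nat.le_ceil _
  obtain ⟨K, hKd, hK0, hK⟩ := exists_natDegree_lt_abs_eval_le k N hk1 hN
  refine ⟨(∏ i ∈ Finset.range r, (1 - C (1 / ((i : ℝ) + 1)) * X)) * K ^ (r + 2), ?_, ?_, ?_⟩
  · have h1 : (∏ i ∈ Finset.range r, (1 - C (1 / ((i : ℝ) + 1)) * X)).natDegree ≤ r := by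
      refine (natDegree_prod_le _ _).trans ((Finset.sum_le_card_nsmul _ _ 1 fun i _ => ?_).trans
        (by simp))
      refine (natDegree_sub_le _ _).trans ?_
      rw [natDegree_one, max_eq_right (Nat.zero_le _)]
      exact (natDegree_C_mul_le _ _).trans natDegree_X_le
    have h2 : (K ^ (r + 2)).natDegree ≤ (r + 2) * (k - 1) :=
      natDegree_pow_le.trans (Nat.mul_le_mul_left _ hKd)
    have h3 : (((k - 1 : ℕ) : ℕ) : ℝ) ≤ √(12 * N / r) := by
      rw [Nat.cast_sub hk1]
      have := Nat.ceil_lt_add_one hs.le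
      push_cast
      linarith
    calc _ ≤ ((r + (r + 2) * (k - 1) : ℕ) : ℝ) := by
          exact_mod_cast natDegree_mul_le.trans (add_le_add h1 h2)
      _ = r + (r + 2) * ((k - 1 : ℕ) : ℝ) := by push_cast; ring
      _ ≤ r + 3 * r * √(12 * N / r) := by
          have : (1 : ℝ) ≤ r := by exact_mod_cast hr
          gcongr
          linarith
      _ = r + 3 * √(12 * N * r) := by
          have : √(12 * N * r) = r * √(12 * N / r) := by
            rw [show 12 * (N : ℝ) * r = r ^ 2 * (12 * N / r) by field_simp,
              Real.sqrt_mul (by positivity), Real.sqrt_sq hr'.le]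
          rw [this]; ring
  · simp [eval_prod, hK0]
  · have hpt : ∀ j ∈ Finset.Icc 1 N,
        |((∏ i ∈ Finset.range r, (1 - C (1 / ((i : ℝ) + 1)) * X)) * K ^ (r + 2)).eval (j : ℝ)| ≤
          (1 / 4) ^ r * (r ^ 2 / 144) * (1 / (j : ℝ) ^ 2) := by
      intro j hj
      rw [Finset.mem_Icc] at hj
      have hj0 : (0 : ℝ) < j := by exact_mod_cast hj.1
      have hprod : |(∏ i ∈ Finset.range r, (1 - C (1 / ((i : ℝ) + 1)) * X)).eval (j : ℝ)| ≤
          (j : ℝ) ^ r / r.factorial := by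
        rw [eval_prod]
        simp only [eval_sub, eval_one, eval_mul, eval_C, eval_X]
        rcases le_or_gt j r with hjr | hjr
        · rw [Finset.prod_eq_zero (i := j - 1) (Finset.mem_range.2 (by omega))]
          · simp; positivity
          · rw [Nat.cast_sub hj.1, Nat.cast_one, sub_add_cancel, one_div_mul_cancel hj0.ne', sub_self]
        · rw [Finset.abs_prod]
          calc _ ≤ ∏ i ∈ Finset.range r, ((j : ℝ) / ((i + 1 : ℕ) : ℝ)) := by
                refine Finset.prod_le_prod (fun _ _ => abs_nonneg _) fun i hi => ?_
                have h1 : 1 ≤ (j : ℝ) / ((i + 1 : ℕ) : ℝ) := by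
                  rw [one_le_div (by positivity)]
                  exact_mod_cast (by have := Finset.mem_range.1 hi; omega)
                push_cast at *
                rw [one_div_mul_eq_div, abs_of_nonpos (by linarith)]
                linarith
            _ = _ := by
                rw [Finset.prod_div_distrib, Finset.prod_const, Finset.card_range,
                  ← Finset.prod_range_add_one_eq_factorial]
                push_cast; rfl
      have hKj : |K.eval (j : ℝ)| ≤ r / (12 * j) := by
        refine (hK j hj0 (by exact_mod_cast hj.2)).trans ?_
        rw [div_le_iff₀ hr'] at hksq
        rw [div_le_div_iff₀ (by positivity) (by positivity)]
        nlinarith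
      have hfac : (r : ℝ) ^ r / r.factorial ≤ 3 ^ r := by
        refine (Real.pow_div_factorial_le_exp _ hr'.le r).trans ?_
        rw [← Real.exp_one_pow]
        exact pow_le_pow_left₀ (Real.exp_pos 1).le (by linarith [Real.exp_one_lt_d9]) r
      rw [eval_mul, eval_pow, abs_mul, abs_pow]
      calc _ ≤ (j : ℝ) ^ r / r.factorial * (r / (12 * j)) ^ (r + 2) := by gcongr
        _ = (r : ℝ) ^ r / r.factorial * ((1 / 12) ^ r * (r ^ 2 / 144) * (1 / (j : ℝ) ^ 2)) := by
            rw [pow_add, div_pow, div_pow, mul_pow, mul_pow, div_pow, one_pow]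
            field_simp
            ring
        _ ≤ 3 ^ r * ((1 / 12) ^ r * (r ^ 2 / 144) * (1 / (j : ℝ) ^ 2)) := by gcongr
        _ = _ := by
            rw [show (1 / 12 : ℝ) = 1 / 4 * (1 / 3) by norm_num, mul_pow, one_div_pow 3]
            field_simp
    calc _ ≤ (2 : ℝ) ^ r * ((1 / 4) ^ r * (r ^ 2 / 144) * 2) := by
          gcongr
          refine (Finset.sum_le_sum hpt).trans ?_
          rw [← Finset.mul_sum]
          gcongr
          exact sum_Icc_one_div_sq_le N
      _ = (r : ℝ) ^ 2 / (72 * 2 ^ r) := by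
          rw [show (1 / 4 : ℝ) = 1 / 2 * (1 / 2) by norm_num, mul_pow, one_div_pow]
          field_simp
          norm_num
      _ < 1 := by
          rw [div_lt_one (by positivity)]
          have : ((r ^ 2 : ℕ) : ℝ) ≤ ((2 * 2 ^ r : ℕ) : ℝ) := by
            exact_mod_cast Nat.sq_le_two_mul_two_pow r
          push_cast at this
          have : (0 : ℝ) < 2 ^ r := by positivity
          linarith

/-- The operator P ↦ X P' multiplies the i-th coefficient by i and lowers the order of vanishing at
1 by at most one; apply it j times and evaluate at 1. -/
theorem sum_coeff_mul_pow_eq_zero {N : ℕ} (j : ℕ) : ∀ {m : ℕ} {P : ℝ[X]}, P.natDegree ≤ N →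
    (X - 1) ^ m ∣ P → j < m → ∑ i ∈ Finset.range (N + 1), P.coeff i * (i : ℝ) ^ j = 0 := by
  induction j with
  | zero =>
    intro m P hP hd hm
    have h : P.eval 1 = 0 := by
      obtain ⟨Q, rfl⟩ := hd
      simp [hm.ne']
    rw [eval_eq_sum_range' (Nat.lt_succ_of_le hP)] at h
    simpa using h
  | succ j ih =>
    intro m P hP hd hm
    obtain ⟨m, rfl⟩ : ∃ m', m = m' + 1 := ⟨m - 1, by omega⟩
    have hd' : (X - 1) ^ m ∣ X * derivative P := by
      refine Dvd.dvd.mul_left ?_ _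
      obtain ⟨Q, rfl⟩ := hd
      rw [derivative_mul, derivative_pow_succ]
      refine dvd_add (Dvd.dvd.mul_right (Dvd.dvd.mul_right (Dvd.intro_left _ rfl) _) _)
        (Dvd.dvd.mul_right (pow_dvd_pow _ (Nat.le_succ m)) _)
    have hdeg : (X * derivative P).natDegree ≤ N := by
      refine natDegree_le_iff_coeff_eq_zero.2 fun i hi => ?_
      obtain ⟨i, rfl⟩ : ∃ i', i = i' + 1 := ⟨i - 1, by omega⟩
      rw [coeff_X_mul, coeff_derivative, coeff_eq_zero_of_natDegree_lt (by omega), zero_mul]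
    rw [← ih hdeg hd' (by omega)]
    refine Finset.sum_congr rfl fun i _ => ?_
    cases i with
    | zero => simp
    | succ i => rw [coeff_X_mul, coeff_derivative, pow_succ]; push_cast; ring

theorem sum_coeff_mul_eval_eq_zero {N m : ℕ} {P g : ℝ[X]} (hP : P.natDegree ≤ N)
    (hd : (X - 1) ^ m ∣ P) (hg : g.natDegree < m) :
    ∑ i ∈ Finset.range (N + 1), P.coeff i * g.eval (i : ℝ) = 0 := by
  simp only [eval_eq_sum_range, Finset.mul_sum]
  rw [Finset.sum_comm]
  refine Finset.sum_eq_zero fun j hj => ?_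
  have h := sum_coeff_mul_pow_eq_zero j hP hd (by have := Finset.mem_range.1 hj; omega)
  calc _ = g.coeff j * ∑ i ∈ Finset.range (N + 1), P.coeff i * (i : ℝ) ^ j := by
        rw [Finset.mul_sum]
        exact Finset.sum_congr rfl fun i _ => by ring
    _ = 0 := by rw [h, mul_zero]

/-- If m exceeded the degree of the concentrated polynomial f, then ∑ a_i f(i) = 0 would give |a_0|
≤ 2^r ∑_{i ≥ 1} |f(i)| < 1, impossible for a nonzero integer a_0. -/
theorem le_of_X_sub_one_pow_dvd {r N m : ℕ} (hr : 1 ≤ r) (hN : 1 ≤ N) {P : ℤ[X]}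
    (hdeg : P.natDegree ≤ N) (hcoeff : ∀ i, |P.coeff i| ≤ 2 ^ r) (h0 : P.coeff 0 ≠ 0)
    (hd : (X - 1) ^ m ∣ P) : (m : ℝ) ≤ r + 3 * √(12 * N * r) := by
  obtain ⟨f, hfd, hf0, hf⟩ := exists_eval_zero_eq_one_sum_abs_eval_lt r N hr hN
  refine le_trans ?_ hfd
  by_contra! hlt
  have hd' : ((X - 1) ^ m : ℝ[X]) ∣ P.map (Int.castRingHom ℝ) := by
    have := Polynomial.map_dvd (Int.castRingHom ℝ) hd
    simpa using this
  have h := sum_coeff_mul_eval_eq_zero (g := f) ((natDegree_map_le).trans hdeg) hd'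
    (by exact_mod_cast hlt)
  rw [Finset.range_eq_Ico, Finset.sum_eq_sum_Ico_succ_bot (by omega)] at h
  simp only [coeff_map, eq_intCast, Nat.cast_zero, hf0, mul_one, zero_add] at h
  have h1 : (1 : ℝ) ≤ |(P.coeff 0 : ℝ)| := by exact_mod_cast Int.one_le_abs h0
  rw [eq_neg_of_add_eq_zero_left h, abs_neg] at h1
  refine absurd (h1.trans (Finset.abs_sum_le_sum_abs _ _)) (not_le.2 (lt_of_le_of_lt ?_ hf))
  rw [Finset.mul_sum]
  refine Finset.sum_le_sum fun i _ => ?_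
  rw [abs_mul]
  gcongr
  exact_mod_cast hcoeff i

end Polynomial

/-! ### A zero-free interval to the left of 1 -/

namespace Polynomial

theorem _root_.Nat.choose_add_le_mul_pow (N a i : ℕ) :
    N.choose (a + i) ≤ N.choose a * N ^ i := by
  induction i with
  | zero => simp
  | succ i ih =>
    calc N.choose (a + i + 1) ≤ N.choose (a + i + 1) * (a + i + 1) :=
          Nat.le_mul_of_pos_right _ (by omega)
      _ = N.choose (a + i) * (N - (a + i)) := Nat.choose_succ_right_eq _ _
      _ ≤ N.choose a * N ^ i * N := Nat.mul_le_mul ih (Nat.sub_le _ _)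
      _ = _ := by ring

theorem _root_.Nat.sum_range_choose_left (N j : ℕ) :
    ∑ i ∈ Finset.range N, i.choose j = N.choose (j + 1) := by
  induction N with
  | zero => simp
  | succ N ih => rw [Finset.sum_range_succ, ih, Nat.choose_succ_succ, add_comm]

theorem abs_coeff_taylor_one_le {D : ℕ} {H : ℤ} {P : ℤ[X]} (hdeg : P.natDegree ≤ D)
    (hcoeff : ∀ i, |P.coeff i| ≤ H) (j : ℕ) :
    |(taylor 1 P).coeff j| ≤ H * (D + 1).choose (j + 1) := by
  have h : (taylor 1 P).coeff j = ∑ i ∈ Finset.range (D + 1), (i.choose j : ℤ) * P.coeff i := by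
    rw [taylor_coeff, hasseDeriv_apply, sum_over_range' _ (by simp) (D + 1) (by omega),
      eval_finsetSum]
    simp
  rw [h]
  calc _ ≤ ∑ i ∈ Finset.range (D + 1), |(i.choose j : ℤ) * P.coeff i| :=
        Finset.abs_sum_le_sum_abs _ _
    _ ≤ ∑ i ∈ Finset.range (D + 1), H * (i.choose j : ℤ) := by
        refine Finset.sum_le_sum fun i _ => ?_
        rw [abs_mul, Nat.abs_cast, mul_comm]
        exact mul_le_mul_of_nonneg_right (hcoeff i) (by positivity)
    _ = _ := by
        rw [← Finset.mul_sum, ← Nat.cast_sum, Nat.sum_range_choose_left]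

theorem X_sub_one_pow_dvd_of_X_pow_dvd_taylor {m : ℕ} {P : ℤ[X]} (h : X ^ m ∣ taylor 1 P) :
    (X - 1) ^ m ∣ P := by
  obtain ⟨Q, hQ⟩ := h
  refine ⟨taylor (-1) Q, ?_⟩
  have h2 := congrArg (taylor (-1)) hQ
  rw [taylor_taylor, taylor_mul, taylor_pow, taylor_X] at h2
  simpa [sub_eq_add_neg] using h2

/-- Expand at 1. The lowest term is an integer multiple of y^m, so at least y^m in modulus, and m is
the order of vanishing at 1. The later terms are dominated by a geometric series of ratio (D + 1)y ≤
1/2 and total at most y^m/2. -/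
theorem aeval_one_sub_ne_zero_of_coeff_zero_ne_zero {r D : ℕ} (hr : 1 ≤ r) (hD : 1 ≤ D) {B : ℝ}
    (hB : ∀ m : ℕ, m ≤ D → (m : ℝ) ≤ r + 3 * √(12 * D * r) → ((D + 1).choose (m + 1) : ℝ) ≤ B)
    {P : ℤ[X]} (hdeg : P.natDegree ≤ D) (hcoeff : ∀ i, |P.coeff i| ≤ 2 ^ r) (h0 : P.coeff 0 ≠ 0)
    {y : ℝ} (hy : 0 < y) (hyB : 4 * (D + 1) * 2 ^ r * B * y ≤ 1) : aeval (1 - y) P ≠ 0 := by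
  set R := taylor 1 P with hR
  have hRne : R ≠ 0 := by
    intro h
    have : P = 0 := taylor_injective 1 (by rw [← hR, h, map_zero])
    simp [this] at h0
  set m := R.natTrailingDegree with hm
  have hmD : m ≤ D := (natTrailingDegree_le_natDegree R).trans (by rwa [hR, natDegree_taylor])
  have hmult := le_of_X_sub_one_pow_dvd hr hD hdeg hcoeff h0
    (X_sub_one_pow_dvd_of_X_pow_dvd_taylor (X_pow_dvd_iff.2 fun d hd =>
      coeff_eq_zero_of_lt_natTrailingDegree hd))
  have hmB := hB m hmD hmult
  have hB1 : 1 ≤ B := le_trans (by exact_mod_cast Nat.choose_pos (by omega)) hmB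
  have heval : aeval (1 - y) P = ∑ j ∈ Finset.range (D + 1), (R.coeff j : ℝ) * (-y) ^ j := by
    have h2 : aeval (1 - y) P = aeval (-y) R := by
      rw [hR, taylor_apply, aeval_comp]
      simp [sub_eq_neg_add]
    rw [h2, aeval_eq_sum_range' (n := D + 1) (by rw [hR, natDegree_taylor]; omega)]
    simp
  have hsplit : aeval (1 - y) P = (R.coeff m : ℝ) * (-y) ^ m +
      ∑ i ∈ Finset.range (D - m), (R.coeff (m + 1 + i) : ℝ) * (-y) ^ (m + 1 + i) := by
    rw [heval, Finset.range_eq_Ico, ← Finset.sum_Ico_consecutive _ (Nat.zero_le m) (by omega),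
      Finset.sum_eq_zero (s := Finset.Ico 0 m), zero_add,
      Finset.sum_eq_sum_Ico_succ_bot (by omega), Finset.sum_Ico_eq_sum_range,
      show D + 1 - (m + 1) = D - m by omega, Finset.range_eq_Ico]
    intro i hi
    rw [coeff_eq_zero_of_lt_natTrailingDegree (by have := Finset.mem_Ico.1 hi; omega)]
    simp
  have h2r : (1 : ℝ) ≤ 2 ^ r := one_le_pow₀ (by norm_num)
  have hz : (D + 1) * y ≤ 1 / 2 := by
    have : 1 ≤ 2 ^ r * B := one_le_mul_of_one_le_of_one_le h2r hB1
    have h3 : 0 < (D + 1) * y := by positivity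
    nlinarith
  have hterm : ∀ i ∈ Finset.range (D - m), |(R.coeff (m + 1 + i) : ℝ) * (-y) ^ (m + 1 + i)| ≤
      y ^ m * (2 ^ r * B * ((D + 1) * y)) * (1 / 2) ^ i := by
    intro i _
    have h3 : |(R.coeff (m + 1 + i) : ℝ)| ≤ 2 ^ r * (B * (D + 1) ^ (i + 1)) := by
      have h4 := abs_coeff_taylor_one_le hdeg hcoeff (m + 1 + i)
      have h5 : |(R.coeff (m + 1 + i) : ℝ)| ≤ 2 ^ r * ((D + 1).choose (m + 1 + i + 1) : ℝ) := by
        exact_mod_cast h4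
      refine h5.trans ?_
      gcongr
      refine le_trans (b := (((D + 1).choose (m + 1) : ℕ) : ℝ) * (D + 1) ^ (i + 1)) ?_ (by gcongr)
      exact_mod_cast Nat.choose_add_le_mul_pow (D + 1) (m + 1) (i + 1)
    rw [abs_mul, abs_pow, abs_neg, abs_of_pos hy]
    calc _ ≤ 2 ^ r * (B * (D + 1) ^ (i + 1)) * y ^ (m + 1 + i) := by gcongr
      _ = y ^ m * (2 ^ r * B * ((D + 1) * y)) * ((D + 1) * y) ^ i := by
          rw [mul_pow]; ring
      _ ≤ _ := by gcongr
  have hrest : |∑ i ∈ Finset.range (D - m), (R.coeff (m + 1 + i) : ℝ) * (-y) ^ (m + 1 + i)| ≤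
      y ^ m / 2 := by
    refine (Finset.abs_sum_le_sum_abs _ _).trans ((Finset.sum_le_sum hterm).trans ?_)
    rw [← Finset.mul_sum]
    calc _ ≤ y ^ m * (2 ^ r * B * ((D + 1) * y)) * 2 := by
          gcongr
          exact sum_geometric_two_le _
      _ = y ^ m * (4 * (D + 1) * 2 ^ r * B * y) / 2 := by ring
      _ ≤ y ^ m * 1 / 2 := by gcongr
      _ = _ := by ring
  have hlead : y ^ m ≤ |(R.coeff m : ℝ) * (-y) ^ m| := by
    have h3 : (1 : ℝ) ≤ |(R.coeff m : ℝ)| := by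
      exact_mod_cast Int.one_le_abs (by rwa [hm, ← trailingCoeff, Ne, trailingCoeff_eq_zero])
    rw [abs_mul, abs_pow, abs_neg, abs_of_pos hy]
    exact le_mul_of_one_le_left (by positivity) h3
  intro hzero
  rw [hsplit] at hzero
  rw [eq_neg_of_add_eq_zero_left hzero, abs_neg] at hlead
  have : 0 < y ^ m := by positivity
  linarith

theorem aeval_one_sub_ne_zero {r D : ℕ} (hr : 1 ≤ r) (hD : 1 ≤ D) {B : ℝ}
    (hB : ∀ m : ℕ, m ≤ D → (m : ℝ) ≤ r + 3 * √(12 * D * r) → ((D + 1).choose (m + 1) : ℝ) ≤ B)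
    {P : ℤ[X]} (hdeg : P.natDegree ≤ D) (hcoeff : ∀ i, |P.coeff i| ≤ 2 ^ r) (hP : P ≠ 0)
    {y : ℝ} (hy : 0 < y) (hy1 : y < 1) (hyB : 4 * (D + 1) * 2 ^ r * B * y ≤ 1) :
    aeval (1 - y) P ≠ 0 := by
  -- Removing the power of X makes the constant term nonzero and does not affect zeros in (0, 1).
  obtain ⟨Q, hQ⟩ : X ^ P.natTrailingDegree ∣ P := X_pow_dvd_iff.2 fun d hd =>
    coeff_eq_zero_of_lt_natTrailingDegree hd
  have hQc : ∀ i, Q.coeff i = P.coeff (i + P.natTrailingDegree) := fun i =>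
    ((congrArg (fun p => p.coeff (i + P.natTrailingDegree)) hQ).trans (coeff_X_pow_mul _ _ _)).symm
  have hQ0 : Q.coeff 0 ≠ 0 := by
    rw [hQc, zero_add]
    rwa [← trailingCoeff, Ne, trailingCoeff_eq_zero]
  have h := aeval_one_sub_ne_zero_of_coeff_zero_ne_zero hr hD hB (P := Q)
    (natDegree_le_iff_coeff_eq_zero.2 fun i hi => by
      rw [hQc, coeff_eq_zero_of_natDegree_lt (by omega)])
    (fun i => by rw [hQc]; exact hcoeff _) hQ0 hy hyB
  rw [hQ, map_mul, map_pow, aeval_X]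
  exact mul_ne_zero (pow_ne_zero _ (by linarith)) h

end Polynomial

/-! ### Numerical estimates for the exponent -/

theorem Nat.cast_choose_le_inv_pow_mul_exp (N j : ℕ) {u : ℝ} (hu : 0 < u) :
    (N.choose j : ℝ) ≤ u⁻¹ ^ j * Real.exp (u * N) := by
  have h : (N.choose j : ℝ) * u ^ j ≤ Real.exp (u * N) := by
    rcases le_or_gt j N with hj | hj
    · calc (N.choose j : ℝ) * u ^ j ≤ ∑ i ∈ Finset.range (N + 1), u ^ i * 1 ^ (N - i) * N.choose i := by
            rw [show (N.choose j : ℝ) * u ^ j = u ^ j * 1 ^ (N - j) * N.choose j by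
              rw [one_pow]; ring]
            exact Finset.single_le_sum (f := fun i => u ^ i * 1 ^ (N - i) * (N.choose i : ℝ))
              (fun i _ => by positivity) (Finset.mem_range.2 (by omega))
        _ = (u + 1) ^ N := (add_pow u 1 N).symm
        _ ≤ Real.exp u ^ N := by gcongr; exact Real.add_one_le_exp u
        _ = _ := by rw [← Real.exp_nat_mul, mul_comm]
    · rw [Nat.choose_eq_zero_of_lt hj]; simp; positivity
  rw [inv_pow, inv_mul_eq_div, le_div_iff₀ (by positivity)]
  exact h

theorem sqrt_mul_eq_mul_sqrt_div {n b : ℕ} (hb : 1 ≤ b) :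
    √((n : ℝ) * b) = b * √((n : ℝ) / b) := by
  have hb' : (0 : ℝ) < b := by exact_mod_cast hb
  rw [show (n : ℝ) * b = b ^ 2 * (n / b) by field_simp, Real.sqrt_mul (by positivity),
    Real.sqrt_sq hb'.le]

theorem two_mul_mul_log_ge {y : ℝ} (hy : 0 < y) : -(3 / 4) ≤ y * (2 * Real.log y) := by
  have he := Real.exp_one_gt_d9
  have h := Real.log_le_sub_one_of_pos (show 0 < (Real.exp 1 * y)⁻¹ by positivity)
  rw [Real.log_inv, Real.log_mul (Real.exp_pos 1).ne' hy.ne', Real.log_exp] at h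
  have h2 : y * (Real.exp 1 * y)⁻¹ = (Real.exp 1)⁻¹ := by
    field_simp
  have h3 : (Real.exp 1)⁻¹ ≤ 3 / 8 := by
    rw [inv_le_comm₀ (Real.exp_pos 1) (by norm_num)]
    linarith
  nlinarith [mul_le_mul_of_nonneg_left h hy.le]

/-- The logarithm is negative for n < b, but with y = √(n/b) the first summand is b · 2y log y ≥
-(2/e) b ≥ -(3/4) b. -/
theorem le_four_mul_howardExponent {n b : ℕ} (hn : 1 ≤ n) (hb : 1 ≤ b) :
    (b : ℝ) ≤ 4 * howardExponent n b := by
  have hn' : (0 : ℝ) < n := by exact_mod_cast hn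
  have hb' : (0 : ℝ) < b := by exact_mod_cast hb
  have hx : (0 : ℝ) < n / b := by positivity
  have h := two_mul_mul_log_ge (Real.sqrt_pos.2 hx)
  rw [Real.log_sqrt hx.le] at h
  rw [howardExponent, sqrt_mul_eq_mul_sqrt_div hb]
  nlinarith [mul_le_mul_of_nonneg_left h hb'.le]

theorem howardExponent_ge {n b : ℕ} (hn : 1 ≤ n) (hb : 1 ≤ b) :
    1 / 4 ≤ howardExponent n b := by
  have h := le_four_mul_howardExponent hn hb
  have : (1 : ℝ) ≤ b := by exact_mod_cast hb
  linarith

theorem sqrt_mul_le_two_mul_howardExponent {n b : ℕ} (hb : 1 ≤ b) (hbn : b ≤ n) :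
    √((n : ℝ) * b) ≤ 2 * howardExponent n b := by
  have hb' : (0 : ℝ) < b := by exact_mod_cast hb
  have hx : (1 : ℝ) ≤ n / b := by
    rw [one_le_div hb']
    exact_mod_cast hbn
  have hl : 0 ≤ Real.log ((n : ℝ) / b) := Real.log_nonneg hx
  rw [howardExponent]
  rcases le_or_gt (1 / 2) (Real.log ((n : ℝ) / b)) with h | h
  · nlinarith [Real.sqrt_nonneg ((n : ℝ) * b)]
  · have h2 : √((n : ℝ) / b) ≤ 2 := by
      rw [Real.sqrt_le_left (by norm_num)]
      have h3 : (n : ℝ) / b < Real.exp (1 / 2) :=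
        (Real.log_lt_iff_lt_exp (by linarith)).1 h
      have h4 : Real.exp (1 / 2) ≤ Real.exp 1 := Real.exp_le_exp.2 (by norm_num)
      linarith [Real.exp_one_lt_d9]
    have h3 : √((n : ℝ) * b) ≤ 2 * b := by
      rw [sqrt_mul_eq_mul_sqrt_div hb]
      nlinarith
    have : 0 ≤ √((n : ℝ) * b) * Real.log ((n : ℝ) / b) := by positivity
    linarith

theorem two_pow_le_exp (n : ℕ) : (2 : ℝ) ^ n ≤ Real.exp n := by
  rw [← mul_one (n : ℝ), Real.exp_nat_mul]
  exact pow_le_pow_left₀ (by norm_num) (by linarith [Real.exp_one_gt_d9]) n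

/-- For n < b the trivial bound 2^(3n+1) suffices, and the total exp(11b) with b ≤ 4X gives the
constant 44. For b ≤ n, m + 1 ≤ 40√(nb), and the binomial bound with u = √(b/n) balances u^(-(m+1))
against exp(u(3n + 1)). -/
theorem exists_choose_bound {n b : ℕ} (hn : 1 ≤ n) (hb : 1 ≤ b) :
    ∃ B : ℝ, (∀ m : ℕ, m ≤ 3 * n →
      (m : ℝ) ≤ (b + 2 : ℕ) + 3 * √(12 * (3 * n : ℕ) * (b + 2 : ℕ)) →
        ((3 * n + 1).choose (m + 1) : ℝ) ≤ B) ∧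
      4 * ((3 * n : ℕ) + 1) * 2 ^ (b + 2) * B ≤ Real.exp (44 * howardExponent n b) := by
  have hn' : (1 : ℝ) ≤ n := by exact_mod_cast hn
  have hb' : (1 : ℝ) ≤ b := by exact_mod_cast hb
  have h2 : (2 : ℝ) ^ (b + 2) ≤ Real.exp (3 * b) :=
    (two_pow_le_exp _).trans (Real.exp_le_exp.2 (by push_cast; linarith))
  have h16 : (16 : ℝ) ≤ Real.exp (3 * b) :=
    calc (16 : ℝ) ≤ Real.exp 1 ^ 3 := by
          refine le_trans ?_ (pow_le_pow_left₀ (by norm_num) Real.exp_one_gt_d9.le 3)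
          norm_num
      _ = Real.exp 3 := by rw [← Real.exp_nat_mul]; norm_num
      _ ≤ _ := Real.exp_le_exp.2 (by linarith)
  have h4n : 4 * (((3 * n : ℕ) : ℝ) + 1) ≤ 16 * n := by push_cast; linarith
  rcases lt_or_ge n b with hnb | hbn
  · have hnb' : (n : ℝ) ≤ b := by exact_mod_cast hnb.le
    have hX := le_four_mul_howardExponent hn hb
    refine ⟨Real.exp (4 * b), fun m _ _ => ?_, ?_⟩
    · calc ((3 * n + 1).choose (m + 1) : ℝ) ≤ ((2 ^ (3 * n + 1) : ℕ) : ℝ) := by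
            exact_mod_cast Nat.choose_le_two_pow _ _
        _ ≤ Real.exp ((3 * n + 1 : ℕ) : ℝ) := by
            push_cast
            exact_mod_cast two_pow_le_exp (3 * n + 1)
        _ ≤ _ := Real.exp_le_exp.2 (by push_cast; linarith)
    · have hexpn : (n : ℝ) ≤ Real.exp b := by linarith [Real.add_one_le_exp (b : ℝ)]
      calc 4 * (((3 * n : ℕ) : ℝ) + 1) * 2 ^ (b + 2) * Real.exp (4 * b) ≤
            Real.exp (3 * b) * Real.exp b * Real.exp (3 * b) * Real.exp (4 * b) := by
            have h5 := h4n.trans (mul_le_mul h16 hexpn (by positivity) (Real.exp_pos _).le)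
            exact mul_le_mul_of_nonneg_right (mul_le_mul h5 h2 (by positivity) (by positivity))
              (Real.exp_pos _).le
        _ = Real.exp (11 * b) := by
            rw [← Real.exp_add, ← Real.exp_add, ← Real.exp_add]; ring_nf
        _ ≤ _ := Real.exp_le_exp.2 (by linarith)
  · set s := √((n : ℝ) * b) with hs
    set X := howardExponent n b with hX
    have hx : (1 : ℝ) ≤ n / b := by
      rw [one_le_div (by linarith)]
      exact_mod_cast hbn
    have hl : 0 ≤ Real.log ((n : ℝ) / b) := Real.log_nonneg hx
    have hsX : s ≤ 2 * X := sqrt_mul_le_two_mul_howardExponent hb hbn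
    have hss : s ^ 2 = n * b := Real.sq_sqrt (by positivity)
    have hs0 : 0 ≤ s := Real.sqrt_nonneg _
    have hbn' : (b : ℝ) ≤ n := by exact_mod_cast hbn
    have hbs : (b : ℝ) ≤ s := by
      rw [hs]; exact Real.le_sqrt_of_sq_le (by nlinarith)
    have hXeq : X = s * Real.log ((n : ℝ) / b) + b := rfl
    have hslX : s * Real.log ((n : ℝ) / b) ≤ X := by linarith
    have hbX : (b : ℝ) ≤ X := by
      have : 0 ≤ s * Real.log ((n : ℝ) / b) := by positivity
      linarith
    set u := √((b : ℝ) / n) with hu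
    have hu0 : 0 < u := Real.sqrt_pos.2 (by positivity)
    have hun : u * n = s := by
      rw [hs, show (n : ℝ) * b = b / n * n ^ 2 by field_simp, Real.sqrt_mul (by positivity),
        Real.sqrt_sq (by positivity)]
    have huinv : u⁻¹ = Real.exp (Real.log ((n : ℝ) / b) / 2) := by
      rw [← Real.log_sqrt (by positivity), Real.exp_log (Real.sqrt_pos.2 (by positivity)),
        hu, ← Real.sqrt_inv, inv_div]
    have hu1 : u ≤ s := by nlinarith
    refine ⟨Real.exp (28 * X), fun m _ hm => ?_, ?_⟩
    · have hroot : √(12 * (3 * n : ℕ) * (b + 2 : ℕ)) ≤ 12 * s := by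
        refine Real.sqrt_le_iff.2 ⟨by positivity, ?_⟩
        push_cast
        nlinarith
      have hm' : ((m + 1 : ℕ) : ℝ) ≤ 40 * s := by push_cast at *; linarith
      calc ((3 * n + 1).choose (m + 1) : ℝ) ≤ u⁻¹ ^ (m + 1) * Real.exp (u * (3 * n + 1 : ℕ)) :=
            Nat.cast_choose_le_inv_pow_mul_exp _ _ hu0
        _ = Real.exp ((m + 1 : ℕ) * (Real.log ((n : ℝ) / b) / 2) + u * (3 * n + 1 : ℕ)) := by
            rw [huinv, ← Real.exp_nat_mul, ← Real.exp_add]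
        _ ≤ _ := by
            refine Real.exp_le_exp.2 ?_
            have h5 := mul_le_mul_of_nonneg_right hm' (show 0 ≤ Real.log ((n : ℝ) / b) / 2 by positivity)
            have h6 : u * (3 * n + 1 : ℕ) = 3 * s + u := by rw [← hun]; push_cast; ring
            rw [h6]
            linarith
    · have hnexp : (n : ℝ) ≤ Real.exp (2 * s) := by
        have h5 := Real.add_one_le_exp s
        have h6 : Real.exp (2 * s) = Real.exp s ^ 2 := by rw [← Real.exp_nat_mul]; norm_num
        rw [h6]
        nlinarith
      calc 4 * (((3 * n : ℕ) : ℝ) + 1) * 2 ^ (b + 2) * Real.exp (28 * X) ≤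
            Real.exp (3 * b) * Real.exp (2 * s) * Real.exp (3 * b) * Real.exp (28 * X) := by
            have h5 := h4n.trans (mul_le_mul h16 hnexp (by positivity) (Real.exp_pos _).le)
            exact mul_le_mul_of_nonneg_right (mul_le_mul h5 h2 (by positivity) (by positivity))
              (Real.exp_pos _).le
        _ = Real.exp (6 * b + 2 * s + 28 * X) := by
            rw [← Real.exp_add, ← Real.exp_add, ← Real.exp_add]; ring_nf
        _ ≤ _ := Real.exp_le_exp.2 (by linarith)

-- By the intermediate value theorem a change of sign would force a zero in the zero-free interval.
open Polynomial in
theorem Polynomial.aeval_nonpos_of_aeval_nonpos {n b : ℕ} (hn : 1 ≤ n) (hb : 1 ≤ b) {P : ℤ[X]}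
    (hdeg : P.natDegree ≤ 3 * n) (hcoeff : ∀ i, |P.coeff i| ≤ 2 ^ (b + 2)) {x y : ℝ}
    (hx : 1 - Real.exp (-(44 * howardExponent n b)) ≤ x) (hx1 : x < 1)
    (hy : 1 - Real.exp (-(44 * howardExponent n b)) ≤ y) (hy1 : y < 1)
    (h : aeval x P ≤ 0) : aeval y P ≤ 0 := by
  by_cases hP : P = 0
  · simp [hP]
  by_contra! hpos
  obtain ⟨z, hz, hz0⟩ := intermediate_value_uIcc (a := x) (b := y)
    (f := fun t => aeval t P) (P.continuous_aeval.continuousOn)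
    (Set.mem_uIcc.2 (Or.inl ⟨h, hpos.le⟩))
  have hz1 : 1 - Real.exp (-(44 * howardExponent n b)) ≤ z ∧ z < 1 := by
    rcases Set.mem_uIcc.1 hz with hz | hz
    · exact ⟨hx.trans hz.1, hz.2.trans_lt hy1⟩
    · exact ⟨hy.trans hz.1, hz.2.trans_lt hx1⟩
  obtain ⟨B, hB, hBX⟩ := exists_choose_bound hn hb
  have hX := howardExponent_ge hn hb
  have hexp : Real.exp (-(44 * howardExponent n b)) < 1 := by
    rw [← Real.exp_zero]
    exact Real.exp_lt_exp.2 (by linarith)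
  refine aeval_one_sub_ne_zero (r := b + 2) (D := 3 * n) (by omega) (by omega) hB hdeg hcoeff hP
    (y := 1 - z) (by linarith) (by linarith) ?_ (by simpa using hz0)
  calc _ ≤ Real.exp (44 * howardExponent n b) * Real.exp (-(44 * howardExponent n b)) := by
        gcongr
        · linarith
        · linarith
    _ = 1 := by rw [← Real.exp_add]; simp

/-! ### Q-value comparisons as signs of integer polynomials -/

theorem Fin.exists_iterate_add_eq {n : ℕ} (g : Fin n → Fin n) (s : Fin n) :
    ∃ c, 1 ≤ c ∧ c ≤ n ∧ ∀ t, n ≤ t → g^[t + c] s = g^[t] s := by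
  obtain ⟨i, j, hij, he⟩ := Fintype.exists_ne_map_eq_of_card_lt
    (fun i : Fin (n + 1) => g^[i] s) (by simp)
  wlog hlt : i < j generalizing i j
  · exact this j i hij.symm he.symm (lt_of_le_of_ne (not_lt.1 hlt) hij.symm)
  have hlt' : (i : ℕ) < j := hlt
  refine ⟨j - i, by omega, by omega, fun t ht => ?_⟩
  rw [show t + (j - i : ℕ) = (t - i) + j by omega, Function.iterate_add_apply]
  rw [← he, ← Function.iterate_add_apply, Nat.sub_add_cancel (by omega)]

namespace DMDP

open Polynomial

variable {n k : ℕ} {M : DMDP (Fin n) (Fin k)} {b : ℕ}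

/-- The reward sequence has period c eventually, so multiplying its power series by 1 - γ^c leaves a
polynomial. Its coefficients are rewards or differences of two rewards in [0, 2^b). -/
theorem exists_polynomial_qValue (hR : ∀ s a, ∃ r : ℕ, r < 2 ^ b ∧ M.R s a = (r : ℝ))
    (π : Fin n → Fin k) (s : Fin n) (a : Fin k) :
    ∃ c, 1 ≤ c ∧ c ≤ n ∧ ∃ W : ℤ[X], W.natDegree ≤ n + c ∧ (∀ i, |W.coeff i| ≤ 2 ^ b) ∧
      ∀ γ : ℝ, 0 ≤ γ → γ < 1 → aeval γ W = (1 - γ ^ c) * M.qValue γ π s a := by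
  choose r hr hRr using hR
  obtain ⟨c, hc1, hcn, hc⟩ := Fin.exists_iterate_add_eq (fun x => M.T x (π x)) (M.T s a)
  -- The pair (s, a) is prepended to the trajectory, which delays the guaranteed periodicity from n
  -- to n + 1.
  set x : ℕ → Fin n := fun t => Nat.casesOn t s (M.trajectory π (M.T s a)) with hx
  set u : ℕ → Fin k := fun t => Nat.casesOn t a fun t => π (x (t + 1)) with hu
  set f : ℕ → ℤ := fun t => r (x t) (u t) with hf
  have hfR : ∀ t, M.R (x t) (u t) = f t := fun t => by rw [hf, hRr]; simp
  have hf0 : ∀ t, 0 ≤ f t := fun t => by simp [hf]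
  have hfb : ∀ t, f t ≤ 2 ^ b := fun t => by
    simp only [hf]
    exact_mod_cast (hr (x t) (u t)).le
  have hfc : ∀ t, n + 1 ≤ t → f (t + c) = f t := by
    intro t ht
    obtain ⟨t, rfl⟩ : ∃ t', t = t' + 1 := ⟨t - 1, by omega⟩
    have h : x (t + 1 + c) = x (t + 1) := by
      rw [show t + 1 + c = t + c + 1 by ring]
      exact hc t (by omega)
    have h2 : u (t + 1 + c) = u (t + 1) := by
      rw [show t + 1 + c = t + c + 1 by ring] at h ⊢
      simp only [hu, h]
    simp only [hf, h, h2]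
  refine ⟨c, hc1, hcn, ∑ i ∈ Finset.range (c + (n + 1)),
    monomial i (f i - if c ≤ i then f (i - c) else 0), ?_, fun i => ?_, fun γ h0 h1 => ?_⟩
  · refine natDegree_sum_le_of_forall_le _ _ fun i hi => (natDegree_monomial_le _).trans ?_
    have := Finset.mem_range.1 hi
    omega
  · rw [finsetSum_coeff]
    simp only [coeff_monomial, Finset.sum_ite_eq', Finset.mem_range]
    have h1 := hf0 i
    have h2 := hfb i
    have h3 := hf0 (i - c)
    have h4 := hfb (i - c)
    rw [abs_le]
    split_ifs <;> constructor <;> linarith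
  · have hs : Summable fun t : ℕ => γ ^ t * (f t : ℝ) := by
      simpa only [hfR] using M.summable_discounted h0 h1 x u
    have hQ : M.qValue γ π s a = ∑' t, γ ^ t * (f t : ℝ) := by
      rw [hs.tsum_eq_zero_add, qValue, value, ← tsum_mul_left, ← hfR 0]
      congr 1
      · simp [hx, hu]
      · refine tsum_congr fun t => ?_
        rw [← hfR (t + 1), pow_succ]
        simp only [hx, hu]
        ring
    have h2 := hs.sum_add_tsum_nat_add (c + (n + 1))
    have h3 := hs.sum_add_tsum_nat_add (n + 1)
    have htail : ∑' i, γ ^ (i + (c + (n + 1))) * (f (i + (c + (n + 1))) : ℝ) =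
        γ ^ c * ∑' i, γ ^ (i + (n + 1)) * (f (i + (n + 1)) : ℝ) := by
      rw [← tsum_mul_left]
      refine tsum_congr fun i => ?_
      rw [show i + (c + (n + 1)) = i + (n + 1) + c by ring, hfc _ (by omega), pow_add γ _ c]
      ring
    have heval : aeval γ (∑ i ∈ Finset.range (c + (n + 1)),
        monomial i (f i - if c ≤ i then f (i - c) else 0)) =
        (∑ i ∈ Finset.range (c + (n + 1)), γ ^ i * (f i : ℝ)) -
          γ ^ c * ∑ i ∈ Finset.range (n + 1), γ ^ i * (f i : ℝ) := by
      have h4 : γ ^ c * ∑ i ∈ Finset.range (n + 1), γ ^ i * (f i : ℝ) =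
          ∑ i ∈ Finset.range (c + (n + 1)), γ ^ i * (if c ≤ i then (f (i - c) : ℝ) else 0) := by
        rw [Finset.sum_range_add _ c (n + 1),
          Finset.sum_eq_zero (s := Finset.range c), zero_add, Finset.mul_sum]
        · refine Finset.sum_congr rfl fun i _ => ?_
          simp [pow_add, mul_assoc]
        · intro i hi
          rw [if_neg (not_le.2 (Finset.mem_range.1 hi)), mul_zero]
      rw [h4, map_sum, ← Finset.sum_sub_distrib]
      refine Finset.sum_congr rfl fun i _ => ?_
      rw [aeval_monomial]
      split_ifs <;> simp <;> ring
    rw [heval, hQ]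
    linear_combination h2 - γ ^ c * h3 - htail

theorem exists_polynomial_qValue_le_iff (hR : ∀ s a, ∃ r : ℕ, r < 2 ^ b ∧ M.R s a = (r : ℝ))
    (π : Fin n → Fin k) (s s' : Fin n) (a a' : Fin k) :
    ∃ P : ℤ[X], P.natDegree ≤ 3 * n ∧ (∀ i, |P.coeff i| ≤ 2 ^ (b + 2)) ∧
      ∀ γ : ℝ, 0 ≤ γ → γ < 1 →
        (aeval γ P ≤ 0 ↔ M.qValue γ π s a ≤ M.qValue γ π s' a') := by
  obtain ⟨c, hc1, hcn, W, hWd, hWc, hW⟩ := exists_polynomial_qValue hR π s a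
  obtain ⟨c', hc1', hcn', W', hWd', hWc', hW'⟩ := exists_polynomial_qValue hR π s' a'
  have hmul : ∀ (d : ℕ) (V : ℤ[X]), (∀ i, |V.coeff i| ≤ 2 ^ b) →
      ∀ i, |((1 - X ^ d) * V).coeff i| ≤ 2 ^ (b + 1) := by
    intro d V hV i
    rw [sub_mul, one_mul, coeff_sub, coeff_X_pow_mul']
    refine (abs_sub _ _).trans ?_
    have h1 := hV i
    have h2 := hV (i - d)
    have h3 : (0 : ℤ) < 2 ^ b := by positivity
    rw [pow_succ]
    split_ifs
    · linarith
    · rw [abs_zero]; linarith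
  have hdeg : ∀ (d e : ℕ) (V : ℤ[X]), d ≤ n → e ≤ n → V.natDegree ≤ n + e →
      ((1 - X ^ d) * V).natDegree ≤ 3 * n := by
    intro d e V hd he hV
    have h : (1 - X ^ d : ℤ[X]).natDegree ≤ d :=
      (natDegree_sub_le _ _).trans (by simp)
    exact natDegree_mul_le.trans (by omega)
  -- Cross-multiplication by the positive factors 1 - γ^c and 1 - γ^c' preserves the sign and costs
  -- a factor 4 in the coefficients.
  refine ⟨(1 - X ^ c') * W - (1 - X ^ c) * W', ?_, fun i => ?_, fun γ h0 h1 => ?_⟩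
  · exact (natDegree_sub_le _ _).trans
      (max_le (hdeg c' c W hcn' hcn hWd) (hdeg c c' W' hcn hcn' hWd'))
  · rw [coeff_sub]
    refine (abs_sub _ _).trans ?_
    have h1 := hmul c' W hWc i
    have h2 := hmul c W' hWc' i
    rw [pow_succ]
    linarith
  · have hp : 0 < 1 - γ ^ c := sub_pos.2 (pow_lt_one₀ h0 h1 (by omega))
    have hp' : 0 < 1 - γ ^ c' := sub_pos.2 (pow_lt_one₀ h0 h1 (by omega))
    have heval : aeval γ ((1 - X ^ c') * W - (1 - X ^ c) * W') =
        (1 - γ ^ c) * (1 - γ ^ c') * (M.qValue γ π s a - M.qValue γ π s' a') := by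
      simp only [map_sub, map_mul, map_one, map_pow, aeval_X, hW γ h0 h1, hW' γ h0 h1]
      ring
    rw [heval, ← sub_nonpos (b := M.qValue γ π s' a')]
    have hpp := mul_pos hp hp'
    exact ⟨fun h => le_of_mul_le_mul_left (h.trans_eq (mul_zero _).symm) hpp,
      fun h => mul_nonpos_of_nonneg_of_nonpos hpp.le h⟩

theorem qValue_le_of_qValue_le (hn : 1 ≤ n) (hb : 1 ≤ b)
    (hR : ∀ s a, ∃ r : ℕ, r < 2 ^ b ∧ M.R s a = (r : ℝ)) {γ γ' : ℝ}
    (h : 1 - Real.exp (-(44 * howardExponent n b)) ≤ γ) (h1 : γ < 1)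
    (h' : 1 - Real.exp (-(44 * howardExponent n b)) ≤ γ') (h1' : γ' < 1)
    {π : Fin n → Fin k} {s s' : Fin n} {a a' : Fin k}
    (hle : M.qValue γ π s a ≤ M.qValue γ π s' a') :
    M.qValue γ' π s a ≤ M.qValue γ' π s' a' := by
  obtain ⟨P, hPd, hPc, hP⟩ := exists_polynomial_qValue_le_iff hR π s s' a a'
  have hX := howardExponent_ge hn hb
  have hexp : Real.exp (-(44 * howardExponent n b)) ≤ 1 := Real.exp_le_one_iff.2 (by linarith)
  rw [← hP γ (by linarith) h1] at hle
  rw [← hP γ' (by linarith) h1']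
  exact aeval_nonpos_of_aeval_nonpos hn hb hPd hPc h h1 h' h1' hle

theorem terminal_iff_qValue_le {γ : ℝ} {π : Fin n → Fin k} :
    M.Terminal γ π ↔ ∀ s a, M.qValue γ π s a ≤ M.qValue γ π s (π s) := by
  simp [Terminal, Improvable]

/-- For γ > 1 - δ the same policy sequence is a run at 1 - δ with the same terminal policies, which
removes the dependence on γ. -/
theorem HowardRun.exists_terminal_of_reward_lt (hn : 1 ≤ n) (hk : 1 ≤ k) (hb : 1 ≤ b)
    (hR : ∀ s a, ∃ r : ℕ, r < 2 ^ b ∧ M.R s a = (r : ℝ)) {γ : ℝ} (h0 : 0 ≤ γ) (h1 : γ < 1)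
    {π : ℕ → Fin n → Fin k} (hrun : M.HowardRun γ π) {τ : ℕ}
    (hτ : (1 - Real.exp (-(44 * howardExponent n b))) ^ τ <
      Real.exp (-(44 * howardExponent n b))) :
    ∃ t ≤ n * k * τ, M.Terminal γ (π t) := by
  have hX := howardExponent_ge hn hb
  have hexp : Real.exp (-(44 * howardExponent n b)) ≤ 1 := Real.exp_le_one_iff.2 (by linarith)
  have hpos := Real.exp_pos (-(44 * howardExponent n b))
  set δ := Real.exp (-(44 * howardExponent n b)) with hδ
  rcases le_or_gt γ (1 - δ) with hγ | hγ
  · refine hrun.exists_terminal hk h0 h1 ?_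
    calc γ ^ τ ≤ (1 - δ) ^ τ := pow_le_pow_left₀ h0 hγ τ
      _ < δ := hτ
      _ ≤ 1 - γ := by linarith
  · have hterm : ∀ π, M.Terminal γ π ↔ M.Terminal (1 - δ) π := fun π => by
      simp only [terminal_iff_qValue_le]
      exact ⟨fun h s a => qValue_le_of_qValue_le hn hb hR hγ.le h1 le_rfl (by linarith) (h s a),
        fun h s a => qValue_le_of_qValue_le hn hb hR le_rfl (by linarith) hγ.le h1 (h s a)⟩
    have hrun' : M.HowardRun (1 - δ) π := fun t ht s a =>
      qValue_le_of_qValue_le hn hb hR hγ.le h1 le_rfl (by linarith)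
        (hrun t (fun i hi => (hterm _).not.2 (ht i hi)) s a)
    obtain ⟨t, ht, hT⟩ := hrun'.exists_terminal hk (by linarith) (by linarith) (τ := τ)
      (by linarith)
    exact ⟨t, ht, (hterm _).2 hT⟩

end DMDP

/-! ### The explicit bound and its growth -/

theorem exists_nat_mul_le_howardBound {n k b : ℕ} (hn : 1 ≤ n) (hb : 1 ≤ b) :
    ∃ τ : ℕ, (1 - Real.exp (-(44 * howardExponent n b))) ^ τ <
      Real.exp (-(44 * howardExponent n b)) ∧ ((n * k * τ : ℕ) : ℝ) ≤ howardBound 60 n k b := by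
  have hX := howardExponent_ge hn hb
  set X := howardExponent n b with hXdef
  have hpos := Real.exp_pos (-(44 * X))
  have hE : Real.exp (-(44 * X)) * Real.exp (44 * X) = 1 := by rw [← Real.exp_add]; simp
  have hle : Real.exp (-(44 * X)) ≤ 1 := Real.exp_le_one_iff.2 (by linarith)
  -- Since (1 - δ)^τ ≤ exp(-δτ), any τ > 44X/δ works. From X ≥ 1/4, τ ≤ 48X exp(44X) and 48 ≤
  -- exp(16X), whence 60 = 44 + 16.
  refine ⟨⌊44 * X * Real.exp (44 * X)⌋₊ + 1, ?_, ?_⟩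
  · calc (1 - Real.exp (-(44 * X))) ^ (⌊44 * X * Real.exp (44 * X)⌋₊ + 1) ≤
          Real.exp (-Real.exp (-(44 * X))) ^ (⌊44 * X * Real.exp (44 * X)⌋₊ + 1) :=
          pow_le_pow_left₀ (by linarith) (Real.one_sub_le_exp_neg _) _
      _ = Real.exp (-(Real.exp (-(44 * X)) * ((⌊44 * X * Real.exp (44 * X)⌋₊ + 1 : ℕ) : ℝ))) := by
          rw [← Real.exp_nat_mul]; ring_nf
      _ < _ := by
          refine Real.exp_lt_exp.2 (neg_lt_neg ?_)
          have h := mul_lt_mul_of_pos_left (Nat.lt_floor_add_one (44 * X * Real.exp (44 * X))) hpos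
          push_cast
          calc 44 * X = Real.exp (-(44 * X)) * (44 * X * Real.exp (44 * X)) := by
                linear_combination -(44 * X) * hE
            _ < _ := h
  · have h1 : ((⌊44 * X * Real.exp (44 * X)⌋₊ + 1 : ℕ) : ℝ) ≤ X * Real.exp (60 * X) := by
      have h2 := Nat.floor_le (show 0 ≤ 44 * X * Real.exp (44 * X) by positivity)
      have h3 : 1 ≤ Real.exp (44 * X) := Real.one_le_exp (by linarith)
      have h4 : (48 : ℝ) ≤ Real.exp (16 * X) :=
        calc (48 : ℝ) ≤ Real.exp 1 ^ 4 := by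
              refine le_trans ?_ (pow_le_pow_left₀ (by norm_num) Real.exp_one_gt_d9.le 4)
              norm_num
          _ = Real.exp 4 := by rw [← Real.exp_nat_mul]; norm_num
          _ ≤ _ := Real.exp_le_exp.2 (by linarith)
      push_cast
      calc _ ≤ X * (48 * Real.exp (44 * X)) := by nlinarith
        _ ≤ X * (Real.exp (16 * X) * Real.exp (44 * X)) := by gcongr
        _ = _ := by rw [← Real.exp_add]; ring_nf
    rw [howardBound, ← hXdef]
    calc _ = (n : ℝ) * k * ((⌊44 * X * Real.exp (44 * X)⌋₊ + 1 : ℕ) : ℝ) := by push_cast; ring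
      _ ≤ (n : ℝ) * k * (X * Real.exp (60 * X)) := by gcongr
      _ = _ := by ring

/-- Use log x = o(√x) at x = n/b and √(nb) · √(n/b) = n. -/
theorem isLittleO_howardExponent {b : ℕ} (hb : 1 ≤ b) :
    (fun n : ℕ => howardExponent n b) =o[atTop] (fun n : ℕ => (n : ℝ)) := by
  have hb' : (0 : ℝ) < b := by exact_mod_cast hb
  have hlog : (fun x : ℝ => Real.log x) =o[atTop] fun x => x ^ (1 / 2 : ℝ) :=
    isLittleO_log_rpow_atTop (by norm_num)
  have hdiv : Tendsto (fun n : ℕ => (n : ℝ) / b) atTop atTop :=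
    tendsto_natCast_atTop_atTop.atTop_div_const hb'
  have h1 : (fun n : ℕ => √((n : ℝ) * b) * Real.log ((n : ℝ) / b)) =o[atTop]
      (fun n : ℕ => √((n : ℝ) * b) * ((n : ℝ) / b) ^ (1 / 2 : ℝ)) :=
    (isBigO_refl _ _).mul_isLittleO (hlog.comp_tendsto hdiv)
  have h2 : (fun n : ℕ => √((n : ℝ) * b) * ((n : ℝ) / b) ^ (1 / 2 : ℝ)) = fun n : ℕ => (n : ℝ) := by
    funext n
    rw [← Real.sqrt_eq_rpow, ← Real.sqrt_mul (by positivity),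
      show (n : ℝ) * b * (n / b) = n ^ 2 by field_simp, Real.sqrt_sq (by positivity)]
  rw [h2] at h1
  exact h1.add ((isLittleO_const_id_atTop (b : ℝ)).comp_tendsto tendsto_natCast_atTop_atTop)

theorem isLittleO_log_howardBound {C : ℝ} {k b : ℕ} (hk : 1 ≤ k) (hb : 1 ≤ b) :
    (fun n : ℕ => Real.log (howardBound C n k b)) =o[atTop] (fun n : ℕ => (n : ℝ)) := by
  have hX := isLittleO_howardExponent hb
  have hk' : (0 : ℝ) < k := by exact_mod_cast hk
  have hcast : Tendsto (fun n : ℕ => (n : ℝ)) atTop atTop := tendsto_natCast_atTop_atTop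
  have hlogn : (fun n : ℕ => Real.log n) =o[atTop] fun n : ℕ => (n : ℝ) :=
    Real.isLittleO_log_id_atTop.comp_tendsto hcast
  have hlogX : (fun n : ℕ => Real.log (howardExponent n b)) =o[atTop] fun n : ℕ => (n : ℝ) := by
    -- From X ≥ 1/4, log X ≥ 1 - 1/X ≥ -3 ≥ -12X, so |log X| ≤ 12X.
    refine IsBigO.trans_isLittleO (IsBigO.of_bound 12 ?_) hX
    filter_upwards [eventually_ge_atTop 1] with n hn
    have h := howardExponent_ge hn hb
    rw [Real.norm_eq_abs, Real.norm_eq_abs, abs_of_nonneg (show 0 ≤ howardExponent n b by linarith),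
      abs_le]
    constructor
    · have h2 := Real.one_sub_inv_le_log_of_pos (show 0 < howardExponent n b by linarith)
      have h3 : (howardExponent n b)⁻¹ ≤ 4 := by
        rw [inv_le_comm₀ (by linarith) (by norm_num)]
        linarith
      have h4 : (howardExponent n b)⁻¹ * howardExponent n b = 1 :=
        inv_mul_cancel₀ (by linarith)
      nlinarith
    · have h2 := Real.log_le_sub_one_of_pos (show 0 < howardExponent n b by linarith)
      linarith
  have hlogk : (fun _ : ℕ => Real.log k) =o[atTop] fun n : ℕ => (n : ℝ) :=
    (isLittleO_const_id_atTop (Real.log k)).comp_tendsto hcast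
  refine (((hlogn.add hlogk).add hlogX).add (hX.const_mul_left C)).congr' ?_ EventuallyEq.rfl
  filter_upwards [eventually_ge_atTop 1] with n hn
  have hn' : (0 : ℝ) < n := by exact_mod_cast hn
  have hXpos : 0 < howardExponent n b := by linarith [howardExponent_ge hn hb]
  rw [howardBound, Real.log_mul (by positivity) (Real.exp_pos _).ne', Real.log_exp,
    Real.log_mul (by positivity) hXpos.ne', Real.log_mul hn'.ne' hk'.ne']

theorem mainTheorem1 :
    ∃ C : ℝ, 0 < C ∧
      (∀ (n k b : ℕ), 1 ≤ n → 1 ≤ k → 1 ≤ b →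
        ∀ M : DMDP (Fin n) (Fin k),
          (∀ s a, ∃ r : ℕ, r < 2 ^ b ∧ M.R s a = (r : ℝ)) →
          ∀ γ : ℝ, 0 ≤ γ → γ < 1 →
            ∀ π : ℕ → Fin n → Fin k, M.HowardRun γ π →
              ∃ t : ℕ, (t : ℝ) ≤ howardBound C n k b ∧ M.Terminal γ (π t)) ∧
      (∀ (k b : ℕ), 1 ≤ k → 1 ≤ b →
        (fun n : ℕ => Real.log (howardBound C n k b)) =o[atTop] (fun n : ℕ => (n : ℝ))) := by
  refine ⟨60, by norm_num, fun n k b hn hk hb M hR γ h0 h1 π hrun => ?_,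
    fun k b hk hb => isLittleO_log_howardBound hk hb⟩
  obtain ⟨τ, hτ, hbound⟩ := exists_nat_mul_le_howardBound (k := k) hn hb
  obtain ⟨t, ht, hT⟩ := hrun.exists_terminal_of_reward_lt hn hk hb hR h0 h1 hτ
  exact ⟨t, le_trans (by exact_mod_cast ht) hbound, hT⟩
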